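/- Let $k\ge 2$ be an integer. A $k$-Pell string is a word over $\{0,1,\ldots,k\}$ that is a concatenation of blocks $0,1,\ldots,k-1$ and $kk$; its length is its number of letters. For $n\ge 0$, the $k$-Pell graph $\Pi_{n,k}$ has as vertices the $k$-Pell strings of length $n$, two of them being adjacent if one can be obtained from the other by replacing one letter $i$ with $i+1$ for some $i\in\{0,\ldots,k-2\}$, or by replacing one factor $(k-1)(k-1)$ with $kk$. For $r\ge 0$, the $r$-cube $Q_r$ is the graph on $\{0,1\}^r$ in which two vertices are adjacent if and only if they differ in exactly one coordinate (so $Q_0=K_1$). The cube polynomial of a finite graph $G$ is $C_G(x)=\sum_{r\ge 0}c_r(G)x^r$, where $c_r(G)$ is the number of induced subgraphs of $G$ isomorphic to $Q_r$. Then, for every $n\ge 2$, $$C_{\Pi_{n,k}}(x)=\bigl(k+(k-1)x\bigr)\,C_{\Pi_{n-1,k}}(x)+(1+x)\,C_{\Pi_{n-2,k}}(x),$$ with the initial values $C_{\Pi_{0,k}}(x)=1$ and $C_{\Pi_{1,k}}(x)=k+(k-1)x$. -/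

import Mathlib

open Polynomial

/-- `IsKPellString k w`: the word `w` is a concatenation of the blocks `0`, `1`, …, `k - 1`
(single letters) and `kk` (two consecutive letters `k`). -/
inductive IsKPellString (k : ℕ) : List ℕ → Prop
  | nil : IsKPellString k []
  | cons {i : ℕ} {w : List ℕ} (hi : i < k) (hw : IsKPellString k w) : IsKPellString k (i :: w)
  | cons_cons {w : List ℕ} (hw : IsKPellString k w) : IsKPellString k (k :: k :: w)

/-- The `k`-Pell strings of length `n` (the length counts letters, so `kk` has length two). -/
def KPellString (n k : ℕ) : Type :=
  {w : List ℕ // IsKPellString k w ∧ w.length = n}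

theorem IsKPellString.le_of_mem {k : ℕ} {w : List ℕ} (h : IsKPellString k w) :
    ∀ a ∈ w, a ≤ k := by
  induction h with
  | nil => simp
  | cons hi _ ih =>
    intro a ha
    rcases List.mem_cons.1 ha with rfl | ha
    · exact hi.le
    · exact ih a ha
  | cons_cons _ ih =>
    intro a ha
    simp only [List.mem_cons] at ha
    rcases ha with rfl | rfl | ha
    · exact le_rfl
    · exact le_rfl
    · exact ih a ha

instance KPellString.instFinite (n k : ℕ) : Finite (KPellString n k) := by
  have hfin : ((List.map (fun i : Fin (k + 1) => (i : ℕ))) ''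
      {l : List (Fin (k + 1)) | l.length = n}).Finite :=
    (List.finite_length_eq (Fin (k + 1)) n).image _
  refine Set.Finite.to_subtype (s := {w | IsKPellString k w ∧ w.length = n}) (hfin.subset ?_)
  rintro w ⟨hw, hl⟩
  have hr : ∀ a ∈ w, ∃ i : Fin (k + 1), (i : ℕ) = a := fun a ha =>
    ⟨⟨a, Nat.lt_succ_of_le (hw.le_of_mem a ha)⟩, rfl⟩
  obtain ⟨l, rfl⟩ : w ∈ Set.range (List.map (fun i : Fin (k + 1) => (i : ℕ))) := by
    rw [Set.range_list_map]
    exact hr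
  exact ⟨l, by simpa using hl, rfl⟩

/-- `KPellStep k u v`: the word `v` is obtained from `u` by replacing one letter `i` with `i + 1`,
where `0 ≤ i ≤ k - 2`, or by replacing one factor `(k - 1)(k - 1)` with `kk`. -/
def KPellStep (k : ℕ) (u v : List ℕ) : Prop :=
  (∃ (a b : List ℕ) (i : ℕ), i + 1 < k ∧ u = a ++ i :: b ∧ v = a ++ (i + 1) :: b) ∨
    ∃ a b : List ℕ, u = a ++ (k - 1) :: (k - 1) :: b ∧ v = a ++ k :: k :: b

/-- The `k`-Pell graph `Π_{n,k}`: distinct `k`-Pell strings of length `n` are adjacent if one of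
them is obtained from the other by a single step. -/
def kPellGraph (n k : ℕ) : SimpleGraph (KPellString n k) :=
  SimpleGraph.fromRel fun u v => KPellStep k u.1 v.1

/-- The `r`-cube `Q_r` on `{0,1}^r`: two vertices are adjacent iff they differ in exactly one
coordinate. For `r = 0` this is the one-vertex graph. -/
def cubeGraph (r : ℕ) : SimpleGraph (Fin r → Bool) where
  Adj x y := ∃ j, x j ≠ y j ∧ ∀ i, i ≠ j → x i = y i
  symm := ⟨fun _ _ ⟨j, hj, h⟩ => ⟨j, hj.symm, fun i hi => (h i hi).symm⟩⟩
  loopless := ⟨fun _ ⟨_, hj, _⟩ => hj rfl⟩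

/-- The number `c_r(G)` of induced `r`-cubes of a finite graph `G`, i.e. of the sets of vertices
that induce a subgraph isomorphic to `Q_r`. -/
noncomputable def inducedCubeCount {V : Type*} [Finite V] (G : SimpleGraph V) (r : ℕ) : ℕ :=
  Set.ncard {S : Set V | Nonempty (G.induce S ≃g cubeGraph r)}

/-- The cube polynomial `C_G(x) = ∑_{i ≥ 0} c_i(G) x ^ i` of a finite graph `G`. The sum may be
cut off because `c_i(G) = 0` for `i > |V(G)|`; see `coeff_cubePolynomial`. -/
noncomputable def cubePolynomial {V : Type*} [Finite V] (G : SimpleGraph V) : ℤ[X] :=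
  ∑ i ∈ Finset.range (Nat.card V + 1), C (inducedCubeCount G i : ℤ) * X ^ i

theorem inducedCubeCount_eq_zero {V : Type*} [Finite V] (G : SimpleGraph V) {r : ℕ}
    (hr : Nat.card V < r) : inducedCubeCount G r = 0 := by
  have hempty : {S : Set V | Nonempty (G.induce S ≃g cubeGraph r)} = ∅ := by
    refine Set.eq_empty_of_forall_notMem ?_
    rintro S ⟨e⟩
    have h1 : Nat.card S = 2 ^ r := by
      rw [Nat.card_congr e.toEquiv]
      simp
    have h2 : Nat.card S ≤ Nat.card V := Finite.card_subtype_le _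
    have h3 : r < 2 ^ r := Nat.lt_two_pow_self
    omega
  rw [inducedCubeCount, hempty, Set.ncard_empty]

theorem coeff_cubePolynomial {V : Type*} [Finite V] (G : SimpleGraph V) (r : ℕ) :
    (cubePolynomial G).coeff r = inducedCubeCount G r := by
  have h := inducedCubeCount_eq_zero G (r := r)
  simp only [cubePolynomial, finsetSum_coeff, coeff_C_mul, coeff_X_pow, mul_ite, mul_one,
    mul_zero, Finset.sum_ite_eq, Finset.mem_range]
  split_ifs with hr
  · rfl
  · rw [h (by omega), Nat.cast_zero]

/-!
The recurrence comes from building `Π_{n,k}` by successive *peripheral expansions*. Suppose the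
vertices of a graph are split into `A` and `B`, where `B` is a copy of a graph `H`, a second copy
of `H` sits inside `A`, and the edges between `A` and `B` are exactly those joining the two copies
of each vertex of `H`. As these edges form a matching, an edge of an induced cube that crosses from
`A` to `B` forces the opposite edge in each square of the cube to cross, and no edge adjacent to it
can cross. Hence an induced cube meeting both sides is cut along a single coordinate
(`exists_cut_coordinate`) and is the prism over an induced cube of `H`. So, adding `B` to `A`
increases the cube polynomial by `(1 + x) C_H(x)` (`cubeCountOn_union_zero`,
`cubeCountOn_union_succ`).

The strings of length `n + 1` that begin with `0` form a copy of `Π_{n,k}`. Adding those that begin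
with `1`, …, `k - 1`, one letter at a time, is each time an expansion with `H = Π_{n,k}`, in which
`j w` is matched with `(j + 1) w`. The strings that begin with `kk` are added by one last expansion
with `H = Π_{n-1,k}`, in which `(k - 1) (k - 1) w` is matched with `k k w`.
-/

/-! ### Adjacency in cubes -/

/-- Deleting a coordinate `j` exhibits the `(r + 1)`-cube as a prism over the `r`-cube. -/
theorem cubeGraph_adj_iff_removeNth {r : ℕ} (j : Fin (r + 1)) (x y : Fin (r + 1) → Bool) :
    (cubeGraph (r + 1)).Adj x y ↔
      (x j ≠ y j ∧ j.removeNth x = j.removeNth y) ∨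
        (x j = y j ∧ (cubeGraph r).Adj (j.removeNth x) (j.removeNth y)) := by
  constructor
  · rintro ⟨i, hi, h⟩
    rcases eq_or_ne i j with rfl | hij
    · exact Or.inl ⟨hi, funext fun l => h _ (Fin.succAbove_ne i l)⟩
    · obtain ⟨l, rfl⟩ := Fin.exists_succAbove_eq hij
      refine Or.inr ⟨h j hij.symm, l, hi, fun m hm => h _ ?_⟩
      exact fun h' => hm (Fin.succAbove_right_injective h')
  · rintro (⟨hj, h⟩ | ⟨hj, l, hl, h⟩)
    · refine ⟨j, hj, fun i hi => ?_⟩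
      obtain ⟨l, rfl⟩ := Fin.exists_succAbove_eq hi
      exact congrFun h l
    · refine ⟨j.succAbove l, hl, fun i hi => ?_⟩
      rcases eq_or_ne i j with rfl | hij
      · exact hj
      · obtain ⟨m, rfl⟩ := Fin.exists_succAbove_eq hij
        exact h m fun h' => hi (by rw [h'])

/-- The vertex obtained from `x` by flipping the coordinate `i`. -/
def flipCoord {r : ℕ} (i : Fin r) (x : Fin r → Bool) : Fin r → Bool :=
  Function.update x i (!x i)

theorem flipCoord_flipCoord {r : ℕ} (i : Fin r) (x : Fin r → Bool) :
    flipCoord i (flipCoord i x) = x := by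
  simp [flipCoord]

theorem flipCoord_comm {r : ℕ} (i j : Fin r) (x : Fin r → Bool) :
    flipCoord i (flipCoord j x) = flipCoord j (flipCoord i x) := by
  rcases eq_or_ne i j with rfl | h
  · rfl
  · simp only [flipCoord, Function.update_of_ne h, Function.update_of_ne h.symm]
    exact Function.update_comm h.symm _ _ _

theorem flipCoord_injective_left {r : ℕ} {i j : Fin r} {x : Fin r → Bool}
    (h : flipCoord i x = flipCoord j x) : i = j := by
  by_contra hij
  have := congrFun h i
  simp [flipCoord, Function.update_of_ne hij] at this

theorem cubeGraph_adj_flipCoord {r : ℕ} (i : Fin r) (x : Fin r → Bool) :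
    (cubeGraph r).Adj x (flipCoord i x) :=
  ⟨i, by simp [flipCoord], fun j hj => by simp [flipCoord, Function.update_of_ne hj]⟩

/-- A property that flipping any coordinate outside `s` preserves passes from `x` to each `y` that
agrees with `x` on `s`. -/
theorem of_forall_flipCoord {r : ℕ} {P : (Fin r → Bool) → Prop} {s : Set (Fin r)}
    (hP : ∀ i, i ∉ s → ∀ x, P x → P (flipCoord i x)) {x y : Fin r → Bool}
    (hxy : ∀ i ∈ s, x i = y i) (hx : P x) : P y := by
  classical
  -- Replace the coordinates of `x` by those of `y` one after the other.
  have key : ∀ t : Finset (Fin r), P (fun i => if i ∈ t then y i else x i) := by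
    intro t
    induction t using Finset.induction_on with
    | empty => simpa using hx
    | insert a t ha ih =>
      by_cases h : x a = y a
      · convert ih using 2 with i
        by_cases hi : i = a
        · subst hi; simp [ha, h]
        · simp [hi]
      · have has : a ∉ s := fun h' => h (hxy a h')
        convert hP a has _ ih using 2 with i
        by_cases hi : i = a
        · subst hi
          simp only [flipCoord, Function.update_self, Finset.mem_insert_self, if_true, ha, if_false]
          revert h; cases x i <;> cases y i <;> simp
        · simp [flipCoord, hi]
  simpa using key Finset.univ

/-! ### Induced cubes inside a set of vertices -/

theorem nonempty_induce_iso_iff {V W : Type*} {G : SimpleGraph V} {K : SimpleGraph W} {S : Set V} :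
    Nonempty (G.induce S ≃g K) ↔ ∃ e : K ↪g G, Set.range e = S := by
  constructor
  · rintro ⟨e⟩
    refine ⟨(SimpleGraph.Embedding.induce S).comp e.symm.toEmbedding, ?_⟩
    ext v
    constructor
    · rintro ⟨x, rfl⟩
      exact (e.symm x).2
    · intro hv
      exact ⟨e ⟨v, hv⟩, by simp⟩
  · rintro ⟨e, rfl⟩
    exact ⟨RelIso.symm ⟨Equiv.ofInjective e e.injective, e.map_adj_iff⟩⟩

/-- The set of vertex sets contained in `A` that induce an `r`-cube. An induced cube is encoded by
an embedding of `cubeGraph r` onto it. -/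
def cubesOn {V : Type*} (G : SimpleGraph V) (A : Set V) (r : ℕ) : Set (Set V) :=
  {S | S ⊆ A ∧ ∃ e : cubeGraph r ↪g G, Set.range e = S}

/-- The number of induced `r`-cubes of `G` all of whose vertices lie in `A`. -/
noncomputable def cubeCountOn {V : Type*} (G : SimpleGraph V) (A : Set V) (r : ℕ) : ℕ :=
  (cubesOn G A r).ncard

section

variable {V W : Type*} {G : SimpleGraph V} {H : SimpleGraph W}

theorem inducedCubeCount_eq_ncard [Finite V] (r : ℕ) :
    inducedCubeCount G r = {S : Set V | ∃ e : cubeGraph r ↪g G, Set.range e = S}.ncard := by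
  simp only [inducedCubeCount, nonempty_induce_iso_iff]

theorem cubeCountOn_univ [Finite V] (r : ℕ) :
    cubeCountOn G Set.univ r = inducedCubeCount G r := by
  simp [inducedCubeCount_eq_ncard, cubeCountOn, cubesOn]

theorem cubeCountOn_range [Finite W] (f : H ↪g G) (r : ℕ) :
    cubeCountOn G (Set.range f) r = inducedCubeCount H r := by
  rw [inducedCubeCount_eq_ncard,
    ← Set.ncard_image_of_injective _ (Set.image_injective.2 f.injective), cubeCountOn]
  congr 1
  ext S
  constructor
  · rintro ⟨hS, e, rfl⟩
    choose g hg using fun x => hS (Set.mem_range_self x)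
    have hadj : ∀ x y, H.Adj (g x) (g y) ↔ (cubeGraph r).Adj x y := fun x y => by
      rw [← f.map_adj_iff, hg, hg, e.map_adj_iff]
    have hinj : Function.Injective g := fun x y h => e.injective (by rw [← hg, ← hg, h])
    refine ⟨Set.range g, ⟨⟨⟨g, hinj⟩, hadj _ _⟩, rfl⟩, ?_⟩
    rw [← Set.range_comp]
    exact congrArg Set.range (funext hg)
  · rintro ⟨_, ⟨e, rfl⟩, rfl⟩
    exact ⟨Set.image_subset_range _ _, f.comp e, by rw [← Set.range_comp]; rfl⟩

theorem cubesOn_disjoint {A B : Set V} (hAB : Disjoint A B) (r : ℕ) :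
    Disjoint (cubesOn G A r) (cubesOn G B r) := by
  rw [Set.disjoint_left]
  rintro _ ⟨hA, e, rfl⟩ ⟨hB, _⟩
  exact Set.disjoint_left.1 hAB (hA (Set.mem_range_self fun _ => false))
    (hB (Set.mem_range_self _))

theorem cubeCountOn_union_zero [Finite V] {A B : Set V} (hAB : Disjoint A B) :
    cubeCountOn G (A ∪ B) 0 = cubeCountOn G A 0 + cubeCountOn G B 0 := by
  rw [cubeCountOn, cubeCountOn, cubeCountOn, ← Set.ncard_union_eq (cubesOn_disjoint hAB 0)]
  congr 1
  ext S
  constructor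
  · rintro ⟨hS, e, rfl⟩
    rw [Set.range_unique, Set.singleton_subset_iff] at hS
    refine hS.imp (fun h => ⟨?_, e, rfl⟩) (fun h => ⟨?_, e, rfl⟩) <;>
      rwa [Set.range_unique, Set.singleton_subset_iff]
  · rintro (⟨hS, h⟩ | ⟨hS, h⟩)
    · exact ⟨hS.trans Set.subset_union_left, h⟩
    · exact ⟨hS.trans Set.subset_union_right, h⟩

/-! ### Peripheral expansions -/

/-- If the edges of a cube between `B` and its complement form a matching and both are nonempty,
then `B` is one of the two faces `x j = c` for some coordinate `j`. -/
theorem exists_cut_coordinate {r : ℕ} {B : Set (Fin r → Bool)}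
    (hmatch : ∀ u v w, (cubeGraph r).Adj u v → (cubeGraph r).Adj u w →
      (u ∈ B ↔ v ∉ B) → (u ∈ B ↔ w ∉ B) → v = w)
    {x y : Fin r → Bool} (hx : x ∈ B) (hy : y ∉ B) :
    ∃ (j : Fin r) (c : Bool), ∀ z, z ∈ B ↔ z j = c := by
  -- Some edge crosses, since the cube is connected.
  obtain ⟨j, z₀, hz₀⟩ : ∃ j z, z ∈ B ↔ flipCoord j z ∉ B := by
    by_contra! hno
    refine hy (of_forall_flipCoord (s := ∅) (P := fun z => z ∈ B) (fun i _ z hz => ?_)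
      (by simp) hx)
    have := hno i z
    tauto
  -- Next to a crossing edge in direction `j`, no edge in another direction crosses.
  have hside : ∀ z, (z ∈ B ↔ flipCoord j z ∉ B) → ∀ i, i ≠ j →
      (z ∈ B ↔ flipCoord i z ∈ B) := by
    intro z hz i hij
    by_contra hcon
    refine hij (flipCoord_injective_left
      (hmatch _ _ _ (cubeGraph_adj_flipCoord i z) (cubeGraph_adj_flipCoord j z) ?_ hz))
    tauto
  have hall : ∀ z, z ∈ B ↔ flipCoord j z ∉ B := by
    intro z
    refine of_forall_flipCoord (s := ∅) (P := fun z => z ∈ B ↔ flipCoord j z ∉ B)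
      (fun i _ z hz => ?_) (by simp) hz₀
    rcases eq_or_ne i j with rfl | hij
    · rw [flipCoord_flipCoord]
      tauto
    · have h1 := hside z hz i hij
      have h2 := hside (flipCoord j z) (by rw [flipCoord_flipCoord]; tauto) i hij
      rw [flipCoord_comm i j] at h2
      tauto
  have hface : ∀ z w : Fin r → Bool, z j = w j → z ∈ B → w ∈ B := fun z w hzw hz =>
    of_forall_flipCoord (s := {j}) (P := fun z => z ∈ B)
      (fun i hi z hz => (hside z (hall z) i hi).1 hz) (by simpa using hzw) hz
  refine ⟨j, x j, fun z => ⟨fun hz => ?_, fun hz => hface x z hz.symm hx⟩⟩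
  by_contra hne
  refine (hall x).1 hx (hface z _ ?_ hz)
  simp only [flipCoord, Function.update_self]
  revert hne
  cases z j <;> cases x j <;> simp

/-- `IsPeripheral A α β` says that attaching the copy `β` of `H` to the set `A` is a peripheral
expansion: `α` is a copy of `H` inside `A`, and the edges between `A` and the copy `β` are those
that join `α w` to `β w`. -/
structure IsPeripheral (A : Set V) (α β : H ↪g G) : Prop where
  left_mem : ∀ w, α w ∈ A
  right_notMem : ∀ w, β w ∉ A
  adj_iff : ∀ a ∈ A, ∀ w, G.Adj a (β w) ↔ a = α w

namespace IsPeripheral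

variable {A : Set V} {α β : H ↪g G}

theorem disjoint (h : IsPeripheral A α β) : Disjoint A (Set.range β) := by
  rw [Set.disjoint_right]
  rintro _ ⟨w, rfl⟩
  exact h.right_notMem w

/-- The prism over an induced cube of `H`. -/
theorem exists_prism (h : IsPeripheral A α β) {r : ℕ} (e : cubeGraph r ↪g H) :
    ∃ e' : cubeGraph (r + 1) ↪g G, Set.range e' = α '' Set.range e ∪ β '' Set.range e := by
  let g : (Fin (r + 1) → Bool) → V := fun x =>
    if x 0 then β (e (Fin.removeNth 0 x)) else α (e (Fin.removeNth 0 x))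
  have hne : ∀ v w, α v ≠ β w := fun v w hvw => h.right_notMem w (hvw ▸ h.left_mem v)
  have hcross : ∀ v w, G.Adj (α v) (β w) ↔ v = w := fun v w => by
    rw [h.adj_iff _ (h.left_mem v), α.injective.eq_iff]
  have hcross' : ∀ v w, G.Adj (β w) (α v) ↔ w = v := fun v w => by
    rw [G.adj_comm, hcross, eq_comm]
  have hinj : Function.Injective g := by
    intro x y hxy
    have hext : x 0 = y 0 → Fin.removeNth 0 x = Fin.removeNth 0 y → x = y := fun h0 h1 => by
      rw [← Fin.insertNth_self_removeNth 0 x, ← Fin.insertNth_self_removeNth 0 y, h0, h1]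
    cases h1 : x 0 <;> cases h2 : y 0 <;>
      simp only [g, h1, h2, if_true, Bool.false_eq_true, if_false] at hxy
    · exact hext (h1.trans h2.symm) (e.injective (α.injective hxy))
    · exact absurd hxy (hne _ _)
    · exact absurd hxy.symm (hne _ _)
    · exact hext (h1.trans h2.symm) (e.injective (β.injective hxy))
  have hadj : ∀ x y, G.Adj (g x) (g y) ↔ (cubeGraph (r + 1)).Adj x y := by
    intro x y
    rw [cubeGraph_adj_iff_removeNth 0]
    cases h1 : x 0 <;> cases h2 : y 0 <;>
      simp [g, h1, h2, hcross, hcross', e.injective.eq_iff]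
  refine ⟨⟨⟨g, hinj⟩, hadj _ _⟩, ?_⟩
  change Set.range g = _
  ext v
  constructor
  · rintro ⟨x, rfl⟩
    cases h1 : x 0
    · exact Or.inl ⟨_, ⟨Fin.removeNth 0 x, rfl⟩, by simp [g, h1]⟩
    · exact Or.inr ⟨_, ⟨Fin.removeNth 0 x, rfl⟩, by simp [g, h1]⟩
  · rintro (⟨_, ⟨x, rfl⟩, rfl⟩ | ⟨_, ⟨x, rfl⟩, rfl⟩)
    · exact ⟨_, (by simp [g] : g (Fin.insertNth 0 false x) = α (e x))⟩
    · exact ⟨_, (by simp [g] : g (Fin.insertNth 0 true x) = β (e x))⟩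

/-- An induced cube that lies in neither part is a prism over an induced cube of `H`. -/
theorem exists_of_crossing (h : IsPeripheral A α β) {r : ℕ} (e : cubeGraph (r + 1) ↪g G)
    (he : Set.range e ⊆ A ∪ Set.range β) (hA : ¬ Set.range e ⊆ A)
    (hB : ¬ Set.range e ⊆ Set.range β) :
    ∃ e' : cubeGraph r ↪g H, Set.range e = α '' Set.range e' ∪ β '' Set.range e' := by
  obtain ⟨_, ⟨x, rfl⟩, hx⟩ := Set.not_subset.1 hA
  obtain ⟨_, ⟨y, rfl⟩, hy⟩ := Set.not_subset.1 hB
  have hmem : ∀ z, e z ∉ Set.range β → e z ∈ A := fun z hz =>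
    (he (Set.mem_range_self z)).resolve_right hz
  obtain ⟨j, c, hc⟩ := exists_cut_coordinate (B := e ⁻¹' Set.range β) (x := x) (y := y) (by
      intro u v w huv huw hu hu'
      rw [← e.map_adj_iff] at huv huw
      apply e.injective
      simp only [Set.mem_preimage] at hu hu'
      by_cases hub : e u ∈ Set.range β
      · obtain ⟨b, hb⟩ := hub
        rw [← hb] at huv huw
        rw [(h.adj_iff _ (hmem v (hu.1 ⟨b, hb⟩)) b).1 huv.symm,
          (h.adj_iff _ (hmem w (hu'.1 ⟨b, hb⟩)) b).1 huw.symm]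
      · obtain ⟨b, hb⟩ : e v ∈ Set.range β := by tauto
        obtain ⟨b', hb'⟩ : e w ∈ Set.range β := by tauto
        rw [← hb] at huv ⊢
        rw [← hb'] at huw ⊢
        rw [α.injective (((h.adj_iff _ (hmem u hub) _).1 huv).symm.trans
          ((h.adj_iff _ (hmem u hub) _).1 huw))])
    ((he (Set.mem_range_self x)).resolve_left hx) hy
  have hβ : ∀ t, e (j.insertNth c t) ∈ Set.range β := fun t => (hc _).2 (by simp)
  choose g hg using hβ
  have hα : ∀ t, e (j.insertNth (!c) t) = α (g t) := fun t => by
    refine (h.adj_iff _ (hmem _ fun h' => ?_) _).1 ?_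
    · simpa using (hc _).1 h'
    · rw [hg, e.map_adj_iff, cubeGraph_adj_iff_removeNth j]
      simp
  have hadj : ∀ s t, H.Adj (g s) (g t) ↔ (cubeGraph r).Adj s t := fun s t => by
    rw [← β.map_adj_iff, hg, hg, e.map_adj_iff, cubeGraph_adj_iff_removeNth j]
    simp
  have hinj : Function.Injective g := fun s t hst => by
    have := e.injective (by rw [← hg, ← hg, hst] :
      e (j.insertNth c s) = e (j.insertNth c t))
    simpa using congrArg j.removeNth this
  refine ⟨⟨⟨g, hinj⟩, hadj _ _⟩, ?_⟩
  change _ = α '' Set.range g ∪ β '' Set.range g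
  ext v
  constructor
  · rintro ⟨z, rfl⟩
    by_cases hz : z j = c
    · exact Or.inr ⟨_, ⟨j.removeNth z, rfl⟩, by rw [hg, ← hz, Fin.insertNth_self_removeNth]⟩
    · have hz' : (!c) = z j := by
        revert hz
        cases z j <;> cases c <;> simp
      exact Or.inl ⟨_, ⟨j.removeNth z, rfl⟩, by rw [← hα, hz', Fin.insertNth_self_removeNth]⟩
  · rintro (⟨_, ⟨t, rfl⟩, rfl⟩ | ⟨_, ⟨t, rfl⟩, rfl⟩)
    · exact ⟨_, hα t⟩
    · exact ⟨_, (hg t).symm⟩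

theorem cubesOn_union_succ (h : IsPeripheral A α β) (r : ℕ) :
    cubesOn G (A ∪ Set.range β) (r + 1) =
      (cubesOn G A (r + 1) ∪ cubesOn G (Set.range β) (r + 1)) ∪
        (fun T => α '' T ∪ β '' T) '' {T | ∃ e : cubeGraph r ↪g H, Set.range e = T} := by
  ext S
  constructor
  · rintro ⟨hS, e, rfl⟩
    by_cases hA : Set.range e ⊆ A
    · exact Or.inl (Or.inl ⟨hA, e, rfl⟩)
    by_cases hB : Set.range e ⊆ Set.range β
    · exact Or.inl (Or.inr ⟨hB, e, rfl⟩)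
    obtain ⟨e', he'⟩ := h.exists_of_crossing e hS hA hB
    exact Or.inr ⟨_, ⟨e', rfl⟩, he'.symm⟩
  · rintro ((⟨hS, h'⟩ | ⟨hS, h'⟩) | ⟨_, ⟨e, rfl⟩, rfl⟩)
    · exact ⟨hS.trans Set.subset_union_left, h'⟩
    · exact ⟨hS.trans Set.subset_union_right, h'⟩
    · refine ⟨Set.union_subset_union ?_ (Set.image_subset_range _ _), h.exists_prism e⟩
      rintro _ ⟨w, _, rfl⟩
      exact h.left_mem w

theorem cubeCountOn_union_succ [Finite V] [Finite W] (h : IsPeripheral A α β) (r : ℕ) :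
    cubeCountOn G (A ∪ Set.range β) (r + 1) =
      cubeCountOn G A (r + 1) + inducedCubeCount H (r + 1) + inducedCubeCount H r := by
  have hinj : Function.Injective fun T : Set W => α '' T ∪ β '' T := by
    -- The part of the prism over `T` that lies outside `A` is `β '' T`.
    have hrec : ∀ T : Set W, β ⁻¹' (α '' T ∪ β '' T) = T := by
      intro T
      ext w
      constructor
      · rintro (⟨v, _, hv⟩ | ⟨v, hv, hvw⟩)
        · exact absurd (hv ▸ h.left_mem v) (h.right_notMem w)
        · exact β.injective hvw ▸ hv
      · exact fun hw => Or.inr ⟨w, hw, rfl⟩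
    intro T T' hT
    rw [← hrec T, ← hrec T']
    exact congrArg _ hT
  have hdisj : Disjoint (cubesOn G A (r + 1) ∪ cubesOn G (Set.range β) (r + 1))
      ((fun T => α '' T ∪ β '' T) '' {T | ∃ e : cubeGraph r ↪g H, Set.range e = T}) := by
    rw [Set.disjoint_right]
    rintro _ ⟨_, ⟨e, rfl⟩, rfl⟩ (⟨hS, _⟩ | ⟨hS, _⟩)
    · exact h.right_notMem (e fun _ => false)
        (hS (Or.inr ⟨_, Set.mem_range_self _, rfl⟩))
    · exact Set.disjoint_left.1 h.disjoint (h.left_mem (e fun _ => false))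
        (hS (Or.inl ⟨_, Set.mem_range_self _, rfl⟩))
  rw [cubeCountOn, h.cubesOn_union_succ, Set.ncard_union_eq hdisj,
    Set.ncard_union_eq (cubesOn_disjoint h.disjoint _), Set.ncard_image_of_injective _ hinj,
    ← inducedCubeCount_eq_ncard, ← cubeCountOn_range β (r + 1), cubeCountOn, cubeCountOn]

end IsPeripheral

end

/-! ### Words and steps -/

theorem kPellStep_cons_cons {k i j : ℕ} {u v : List ℕ} :
    KPellStep k (i :: u) (j :: v) ↔
      (i + 1 = j ∧ j < k ∧ u = v) ∨ (i = j ∧ KPellStep k u v) ∨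
        (i = k - 1 ∧ j = k ∧ ∃ b, u = (k - 1) :: b ∧ v = k :: b) := by
  constructor
  · rintro (⟨a, b, l, hl, hu, hv⟩ | ⟨a, b, hu, hv⟩)
    · cases a with
      | nil =>
        simp only [List.nil_append, List.cons.injEq] at hu hv
        obtain ⟨rfl, rfl⟩ := hu
        obtain ⟨rfl, rfl⟩ := hv
        exact Or.inl ⟨rfl, hl, rfl⟩
      | cons d a =>
        simp only [List.cons_append, List.cons.injEq] at hu hv
        exact Or.inr (Or.inl ⟨hu.1.trans hv.1.symm, Or.inl ⟨a, b, l, hl, hu.2, hv.2⟩⟩)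
    · cases a with
      | nil =>
        simp only [List.nil_append, List.cons.injEq] at hu hv
        exact Or.inr (Or.inr ⟨hu.1, hv.1, b, hu.2, hv.2⟩)
      | cons d a =>
        simp only [List.cons_append, List.cons.injEq] at hu hv
        exact Or.inr (Or.inl ⟨hu.1.trans hv.1.symm, Or.inr ⟨a, b, hu.2, hv.2⟩⟩)
  · rintro (⟨rfl, hj, rfl⟩ | ⟨rfl, ⟨a, b, l, hl, rfl, rfl⟩ | ⟨a, b, rfl, rfl⟩⟩ |
      ⟨rfl, rfl, b, rfl, rfl⟩)
    · exact Or.inl ⟨[], u, i, hj, rfl, rfl⟩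
    · exact Or.inl ⟨i :: a, b, l, hl, rfl, rfl⟩
    · exact Or.inr ⟨i :: a, b, rfl, rfl⟩
    · exact Or.inr ⟨[], b, rfl, rfl⟩

theorem isKPellString_cons_iff {k i : ℕ} (hi : i < k) {w : List ℕ} :
    IsKPellString k (i :: w) ↔ IsKPellString k w := by
  refine ⟨fun h => ?_, IsKPellString.cons hi⟩
  cases h with
  | cons _ hw => exact hw
  | cons_cons hw => omega

theorem kPellGraph_adj {n k : ℕ} {u v : KPellString n k} :
    (kPellGraph n k).Adj u v ↔ u.1 ≠ v.1 ∧ (KPellStep k u.1 v.1 ∨ KPellStep k v.1 u.1) := by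
  rw [kPellGraph, SimpleGraph.fromRel_adj, Ne]
  exact and_congr_left' (not_congr Subtype.ext_iff)

namespace KPellString

variable {k : ℕ}

/-- The embedding `w ↦ i w` of `Π_{n,k}` into `Π_{n+1,k}`, for a letter `i < k`. -/
def consEmb (n : ℕ) {i : ℕ} (hi : i < k) : kPellGraph n k ↪g kPellGraph (n + 1) k where
  toFun w := ⟨i :: w.1, w.2.1.cons hi, by simp [w.2.2]⟩
  inj' u v h := Subtype.ext (List.cons.inj (congrArg Subtype.val h)).2
  map_rel_iff' {u v} := by
    have hik : i ≠ k := hi.ne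
    rw [kPellGraph_adj, kPellGraph_adj]
    change (i :: u.1 ≠ i :: v.1 ∧ (KPellStep k (i :: u.1) (i :: v.1) ∨
      KPellStep k (i :: v.1) (i :: u.1))) ↔ _
    simp [kPellStep_cons_cons, hik]

/-- The embedding `w ↦ k k w` of `Π_{n,k}` into `Π_{n+2,k}`. The case `k = 0` has to be excluded,
since `k - 1` is `0` there. -/
def consConsEmb (n : ℕ) (hk : 0 < k) : kPellGraph n k ↪g kPellGraph (n + 2) k where
  toFun w := ⟨k :: k :: w.1, w.2.1.cons_cons, by simp [w.2.2]⟩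
  inj' u v h := Subtype.ext (List.cons.inj (List.cons.inj (congrArg Subtype.val h)).2).2
  map_rel_iff' {u v} := by
    have hk' : k ≠ k - 1 := by omega
    rw [kPellGraph_adj, kPellGraph_adj]
    change (k :: k :: u.1 ≠ k :: k :: v.1 ∧ (KPellStep k (k :: k :: u.1) (k :: k :: v.1) ∨
      KPellStep k (k :: k :: v.1) (k :: k :: u.1))) ↔ _
    simp [kPellStep_cons_cons, hk']

/-- The `k`-Pell strings of length `n + 1` whose first letter is less than `j`. -/
def headLT (n k j : ℕ) : Set (KPellString (n + 1) k) :=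
  {u | ∃ i < j, ∃ w, u.1 = i :: w}

theorem headLT_zero (n : ℕ) : headLT n k 0 = ∅ := by
  simp [headLT]

theorem headLT_succ (n : ℕ) {j : ℕ} (hj : j < k) :
    headLT n k (j + 1) = headLT n k j ∪ Set.range (consEmb n hj) := by
  ext u
  constructor
  · rintro ⟨i, hi, w, hw⟩
    rcases Nat.lt_succ_iff_lt_or_eq.1 hi with hi | rfl
    · exact Or.inl ⟨i, hi, w, hw⟩
    · have hu := u.2
      rw [hw, isKPellString_cons_iff hj, List.length_cons, Nat.add_right_cancel_iff] at hu
      exact Or.inr ⟨⟨w, hu⟩, Subtype.ext hw.symm⟩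
  · rintro (⟨i, hi, w, hw⟩ | ⟨w, rfl⟩)
    · exact ⟨i, hi.trans j.lt_succ_self, w, hw⟩
    · exact ⟨j, j.lt_succ_self, w.1, rfl⟩

theorem headLT_zero_eq_univ : headLT 0 k k = Set.univ := by
  refine Set.eq_univ_of_forall fun u => ?_
  obtain ⟨u, hu, hl⟩ := u
  cases hu with
  | nil => simp at hl
  | cons hi hw => exact ⟨_, hi, _, rfl⟩
  | cons_cons hw => simp at hl

theorem headLT_succ_union (n : ℕ) (hk : 0 < k) :
    headLT (n + 1) k k ∪ Set.range (consConsEmb n hk) = Set.univ := by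
  refine Set.eq_univ_of_forall fun u => ?_
  obtain ⟨u, hu, hl⟩ := u
  cases hu with
  | nil => simp at hl
  | cons hi hw => exact Or.inl ⟨_, hi, _, rfl⟩
  | cons_cons hw => exact Or.inr ⟨⟨_, hw, by simpa using hl⟩, rfl⟩

theorem isPeripheral_headLT (n : ℕ) {j : ℕ} (hj : j + 1 < k) :
    IsPeripheral (headLT n k (j + 1)) (consEmb n (Nat.lt_of_succ_lt hj)) (consEmb n hj) where
  left_mem w := ⟨j, j.lt_succ_self, w.1, rfl⟩
  right_notMem := by
    rintro w ⟨i, hi, v, hv⟩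
    exact hi.ne (List.cons.inj hv).1.symm
  adj_iff := by
    rintro a ⟨i, hi, v, hv⟩ w
    have h1 : i ≠ j + 1 := hi.ne
    have h2 : j + 1 ≠ k := hj.ne
    have h3 : i ≠ k := by omega
    have h4 : j + 1 + 1 ≠ i := by omega
    rw [kPellGraph_adj]
    refine Iff.trans ?_ Subtype.ext_iff.symm
    change (a.1 ≠ (j + 1) :: w.1 ∧ (KPellStep k a.1 ((j + 1) :: w.1) ∨
      KPellStep k ((j + 1) :: w.1) a.1)) ↔ a.1 = j :: w.1
    rw [hv]
    simp [kPellStep_cons_cons, h1, h1.symm, h2, h3, h4, hj]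

theorem isPeripheral_consCons (n : ℕ) (hk : 0 < k) :
    IsPeripheral (headLT (n + 1) k k)
      ((consEmb (n + 1) (Nat.sub_lt hk one_pos)).comp (consEmb n (Nat.sub_lt hk one_pos)))
      (consConsEmb n hk) where
  left_mem w := ⟨k - 1, Nat.sub_lt hk one_pos, (k - 1) :: w.1, rfl⟩
  right_notMem := by
    rintro w ⟨i, hi, v, hv⟩
    exact hi.ne (List.cons.inj hv).1.symm
  adj_iff := by
    rintro a ⟨i, hi, v, hv⟩ w
    have h1 : i ≠ k := hi.ne
    have h2 : k ≠ k - 1 := by omega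
    have h3 : k + 1 ≠ i := by omega
    rw [kPellGraph_adj]
    refine Iff.trans ?_ Subtype.ext_iff.symm
    change (a.1 ≠ k :: k :: w.1 ∧ (KPellStep k a.1 (k :: k :: w.1) ∨
      KPellStep k (k :: k :: w.1) a.1)) ↔ a.1 = (k - 1) :: (k - 1) :: w.1
    rw [hv]
    simp [kPellStep_cons_cons, h1, h1.symm, h2, h3]

/-! ### Counting cubes in `k`-Pell graphs -/

theorem cubeCountOn_headLT_zero (n : ℕ) {j : ℕ} (hj : j ≤ k) :
    cubeCountOn (kPellGraph (n + 1) k) (headLT n k j) 0 =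
      j * inducedCubeCount (kPellGraph n k) 0 := by
  induction j with
  | zero =>
    rw [headLT_zero, cubeCountOn, zero_mul, Set.ncard_eq_zero]
    refine Set.eq_empty_of_forall_notMem ?_
    rintro _ ⟨hS, e, rfl⟩
    exact hS (Set.mem_range_self fun _ => false)
  | succ j ih =>
    rw [headLT_succ n hj, cubeCountOn_union_zero, ih (Nat.le_of_succ_le hj), cubeCountOn_range,
      Nat.succ_mul]
    rw [Set.disjoint_right]
    rintro _ ⟨w, rfl⟩ ⟨i, hi, v, hv⟩
    exact hi.ne (List.cons.inj hv).1.symm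

theorem cubeCountOn_headLT_succ (n r : ℕ) {j : ℕ} (hj : j < k) :
    cubeCountOn (kPellGraph (n + 1) k) (headLT n k (j + 1)) (r + 1) =
      (j + 1) * inducedCubeCount (kPellGraph n k) (r + 1) +
        j * inducedCubeCount (kPellGraph n k) r := by
  induction j with
  | zero => rw [headLT_succ n hj, headLT_zero, Set.empty_union, cubeCountOn_range]; ring
  | succ j ih =>
    rw [headLT_succ n hj, (isPeripheral_headLT n hj).cubeCountOn_union_succ,
      ih (Nat.lt_of_succ_lt hj)]
    ring

end KPellString

open KPellString

theorem coeff_zero_recurrence (k : ℕ) (p : ℤ[X]) :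
    (((k : ℤ[X]) + ((k : ℤ[X]) - 1) * X) * p).coeff 0 = k * p.coeff 0 := by
  simp [mul_coeff_zero]

theorem coeff_succ_recurrence (k : ℕ) (p : ℤ[X]) (r : ℕ) :
    (((k : ℤ[X]) + ((k : ℤ[X]) - 1) * X) * p).coeff (r + 1) =
      k * p.coeff (r + 1) + (k - 1) * p.coeff r := by
  have h : ((k : ℤ[X]) + ((k : ℤ[X]) - 1) * X) * p = C (k : ℤ) * p + C ((k : ℤ) - 1) * (p * X) := by
    simp
    ring
  rw [h, coeff_add, coeff_C_mul, coeff_C_mul, coeff_mul_X]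

theorem cubePolynomial_kPellGraph_zero (k : ℕ) : cubePolynomial (kPellGraph 0 k) = 1 := by
  have hss : Subsingleton (KPellString 0 k) :=
    ⟨fun u v => Subtype.ext <| by
      rw [List.eq_nil_of_length_eq_zero u.2.2, List.eq_nil_of_length_eq_zero v.2.2]⟩
  let u : KPellString 0 k := ⟨[], IsKPellString.nil, rfl⟩
  ext r
  rw [coeff_cubePolynomial, inducedCubeCount_eq_ncard, coeff_one]
  cases r with
  | zero =>
    have : {S : Set (KPellString 0 k) | ∃ e : cubeGraph 0 ↪g kPellGraph 0 k, Set.range e = S} =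
        {{u}} := by
      ext S
      constructor
      · rintro ⟨e, rfl⟩
        rw [Set.range_unique, Set.mem_singleton_iff]
        exact congrArg _ (Subsingleton.elim _ _)
      · rintro rfl
        refine ⟨⟨⟨fun _ => u, fun _ _ _ => Subsingleton.elim _ _⟩, fun {a b} => ?_⟩, ?_⟩
        · simp [Subsingleton.elim a b]
        · exact Set.range_const
    simp [this]
  | succ r =>
    have : {S : Set (KPellString 0 k) |
        ∃ e : cubeGraph (r + 1) ↪g kPellGraph 0 k, Set.range e = S} = ∅ := by
      refine Set.eq_empty_of_forall_notMem ?_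
      rintro _ ⟨e, _⟩
      have h := e.injective (Subsingleton.elim (e fun _ => false) (e fun _ => true))
      simpa using congrFun h 0
    simp [this]

theorem mainTheorem6 (k : ℕ) (hk : 2 ≤ k) :
    (∀ n : ℕ, 2 ≤ n →
      cubePolynomial (kPellGraph n k) =
        ((k : ℤ[X]) + ((k : ℤ[X]) - 1) * X) * cubePolynomial (kPellGraph (n - 1) k) +
          (1 + X) * cubePolynomial (kPellGraph (n - 2) k)) ∧
    cubePolynomial (kPellGraph 0 k) = 1 ∧
    cubePolynomial (kPellGraph 1 k) = (k : ℤ[X]) + ((k : ℤ[X]) - 1) * X := by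
  obtain ⟨m, rfl⟩ : ∃ m, k = m + 1 := ⟨k - 1, by omega⟩
  refine ⟨fun n hn => ?_, cubePolynomial_kPellGraph_zero _, ?_⟩
  · obtain ⟨n, rfl⟩ := Nat.exists_eq_add_of_le' hn
    rw [Nat.add_sub_cancel, show n + 2 - 1 = n + 1 from rfl]
    have hper := isPeripheral_consCons n m.succ_pos
    ext r
    cases r with
    | zero =>
      rw [coeff_add, coeff_zero_recurrence]
      simp only [mul_coeff_zero, coeff_cubePolynomial]
      rw [← cubeCountOn_univ, ← headLT_succ_union n m.succ_pos,
        cubeCountOn_union_zero hper.disjoint, cubeCountOn_headLT_zero _ le_rfl, cubeCountOn_range]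
      simp
    | succ r =>
      rw [coeff_add, coeff_succ_recurrence, add_mul, one_mul, coeff_add, coeff_X_mul]
      simp only [coeff_cubePolynomial]
      rw [← cubeCountOn_univ, ← headLT_succ_union n m.succ_pos, hper.cubeCountOn_union_succ,
        cubeCountOn_headLT_succ _ _ m.lt_succ_self]
      push_cast
      ring
  · -- `Π_{1,k}` arises from `Π_{0,k}` by the expansions for the first letters alone.
    have hmul (p : ℤ[X]) : p * cubePolynomial (kPellGraph 0 (m + 1)) = p := by
      rw [cubePolynomial_kPellGraph_zero, mul_one]
    rw [← hmul ((_ : ℤ[X]) + _)]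
    ext r
    cases r with
    | zero =>
      rw [coeff_zero_recurrence]
      simp only [coeff_cubePolynomial]
      rw [← cubeCountOn_univ, ← headLT_zero_eq_univ, cubeCountOn_headLT_zero _ le_rfl]
      push_cast
      ring
    | succ r =>
      rw [coeff_succ_recurrence]
      simp only [coeff_cubePolynomial]
      rw [← cubeCountOn_univ, ← headLT_zero_eq_univ, cubeCountOn_headLT_succ _ _ m.lt_succ_self]
      push_cast
      ring
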